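/- Inner products are antilinear in the first argument. Let $(q_k)_{k\ge1}$ be real numbers and $(b_k)_{k\ge1}$ positive numbers. Let $J_0$ be the operator in $\ell_2(\mathbb N)$, $\mathbb N=\{1,2,\dots\}$, defined on the finitely supported sequences by $(J_0\phi)_1=q_1\phi_1+b_1\phi_2$ and $(J_0\phi)_k=b_{k-1}\phi_{k-1}+q_k\phi_k+b_k\phi_{k+1}$ for $k\ge2$, and let $J=\overline{J_0}$ be the associated Jacobi operator. Let $\delta_1$ be the first vector of the canonical basis, $\mathcal I$ the componentwise complex conjugation on $\ell_2(\mathbb N)$, and $\pi(z)=(\pi_k(z))_{k\ge1}$ the polynomials of the first kind: $\pi_1=1$, $z\pi_1=q_1\pi_1+b_1\pi_2$, $z\pi_k=b_{k-1}\pi_{k-1}+q_k\pi_k+b_k\pi_{k+1}$ for $k\ge2$. Definitions. A closed operator $A$ in a Hilbert space $\mathcal H$ is regular if for every $z\in\mathbb C$ there is $C>0$ with $\|(A-zI)\phi\|\ge C\|\phi\|$ for all $\phi\in\operatorname{dom}A$. For $\mu\in\mathcal H$ let $S_\mu$ be the set of those $z\in\mathbb C$ for which $\mathcal H=\operatorname{ran}(A-zI)\dotplus\operatorname{span}\{\mu\}$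 (algebraic direct sum) fails; $\mu$ is a gauge of $A$ if $S_\mu$ is at most countable, and an entire gauge if moreover $S_\mu=\emptyset$. A regular, densely defined symmetric operator $A$ with $\dim\ker(A^*- iI)=\dim\ker(A^*+iI)=1$ is entire (in Krein's sense) if it has an entire gauge. A conjugation is an antilinear involution $\mathcal C$ of $\mathcal H$ with $\langle\mathcal C\phi,\mathcal C\psi\rangle=\langle\psi,\phi\rangle$; it commutes with $A$ if $\mathcal C\operatorname{dom}A\subset\operatorname{dom}A$ and $A\mathcal C\phi=\mathcal CA\phi$ for $\phi\in\operatorname{dom}A$. Proposition. If $J$ is not selfadjoint, then $J$ is an entire operator (in particular it is regular and has deficiency indices $(1,1)$), and $\delta_1$ is an entire gauge of $J$. Moreover, $\mathcal I$ is a conjugation commuting with $J$; for every $z\in\mathbb C$ the sequence $\pi(z)$ belongs to $\ell_2(\mathbb N)$; and the function $\xi=\pi:\mathbb C\to\ell_2(\mathbb N)$ is entire and zero-free and satisfies $\xi(z)\in\ker(J^*-zI)$, $\mathcal I\xi(z)=\xi(\overline z)$ and $\langle\xi(\overline z),\delta_1\rangle=1$ for all $z\in\mathbb C$. -/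

import Mathlib

open scoped ComplexConjugate InnerProductSpace

/-- The Hilbert space `ℓ²(ℕ)` of square summable complex sequences. The index `k : ℕ` stands for
the positive integer `k + 1`. -/
abbrev L2Seq : Type := lp (fun _ : ℕ => ℂ) 2

noncomputable section

/-! ### Operators in a Hilbert space -/

section Operators

variable {H : Type*} [NormedAddCommGroup H] [InnerProductSpace ℂ H]

/-- A (densely defined) symmetric operator: `⟪A φ, ψ⟫ = ⟪φ, A ψ⟫` for `φ, ψ ∈ dom A`. -/
structure IsSymmetricOperator (A : H →ₗ.[ℂ] H) : Prop where
  dense_domain : Dense (A.domain : Set H)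
  symmetric : A.IsFormalAdjoint A

/-- `ran (A - z I)`. -/
def rangeSub (A : H →ₗ.[ℂ] H) (z : ℂ) : Submodule ℂ H :=
  LinearMap.range (A.toFun - z • A.domain.subtype)

/-- `ker (B - z I)`, as a subspace of `H` (it consists of `φ ∈ dom B` with `B φ = z φ`). -/
def kernelSub (B : H →ₗ.[ℂ] H) (z : ℂ) : Submodule ℂ H :=
  (LinearMap.ker (B.toFun - z • B.domain.subtype)).map B.domain.subtype

/-- The deficiency index `n₊(A) = dim ker (A* - i I)`. -/
def deficiencyIndexPos [CompleteSpace H] (A : H →ₗ.[ℂ] H) : Cardinal :=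
  Module.rank ℂ (kernelSub A.adjoint Complex.I)

/-- The deficiency index `n₋(A) = dim ker (A* + i I)`. -/
def deficiencyIndexNeg [CompleteSpace H] (A : H →ₗ.[ℂ] H) : Cardinal :=
  Module.rank ℂ (kernelSub A.adjoint (-Complex.I))

/-- Regular operators: closed operators `A` such that `A - z I` is bounded from below for
every `z ∈ ℂ`. -/
structure IsRegularOperator (A : H →ₗ.[ℂ] H) : Prop where
  isClosed : A.IsClosed
  bounded_below : ∀ z : ℂ, ∃ C : ℝ, 0 < C ∧
    ∀ φ : A.domain, C * ‖(φ : H)‖ ≤ ‖A φ - z • (φ : H)‖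

/-- The exceptional set `S_μ`: the points `z` where `H = ran (A - z I) ∔ span {μ}` fails. -/
def exceptionalSet (A : H →ₗ.[ℂ] H) (μ : H) : Set ℂ :=
  {z | ¬ IsCompl (rangeSub A z) (Submodule.span ℂ {μ})}

/-- `μ` is a gauge of `A`: `H = ran (A - z I) ∔ span {μ}` for all but at most countably
many `z`. -/
def IsGauge (A : H →ₗ.[ℂ] H) (μ : H) : Prop :=
  (exceptionalSet A μ).Countable

/-- An entire gauge is a gauge with empty exceptional set. -/
def IsEntireGauge (A : H →ₗ.[ℂ] H) (μ : H) : Prop :=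
  IsGauge A μ ∧ exceptionalSet A μ = ∅

/-- Entire operators in the sense of Krein: regular symmetric operators with deficiency indices
`(1, 1)` which have an entire gauge. -/
structure IsEntireOperator [CompleteSpace H] (A : H →ₗ.[ℂ] H) : Prop where
  regular : IsRegularOperator A
  symmetric : IsSymmetricOperator A
  deficiency_pos : deficiencyIndexPos A = 1
  deficiency_neg : deficiencyIndexNeg A = 1
  exists_gauge : ∃ μ : H, IsEntireGauge A μ

/-- A conjugation: an antilinear involution with `⟪I φ, I ψ⟫ = ⟪ψ, φ⟫`. -/
structure IsConjugation (I : H → H) : Prop where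
  map_add : ∀ φ ψ, I (φ + ψ) = I φ + I ψ
  map_smul : ∀ (c : ℂ) (φ : H), I (c • φ) = conj c • I φ
  involutive : ∀ φ, I (I φ) = φ
  inner_map : ∀ φ ψ, ⟪I φ, I ψ⟫_ℂ = ⟪ψ, φ⟫_ℂ

/-- `I` commutes with `A`: it maps `dom A` into itself and `A I φ = I A φ` on `dom A`. -/
def CommutesWith (I : H → H) (A : H →ₗ.[ℂ] H) : Prop :=
  ∀ φ : A.domain, ∃ h : I φ ∈ A.domain, A ⟨I φ, h⟩ = I (A φ)

/-- `ξ : ℂ → H` is a zero-free entire function with values `ξ z ∈ ker (A* - z I)`, which is real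
with respect to the conjugation `I`. -/
structure IsKreinFunction [CompleteSpace H] (A : H →ₗ.[ℂ] H) (I : H → H) (ξ : ℂ → H) : Prop where
  entire : Differentiable ℂ ξ
  zero_free : ∀ z, ξ z ≠ 0
  mem_kernel : ∀ z, ξ z ∈ kernelSub A.adjoint z
  real : ∀ z, I (ξ z) = ξ (conj z)

end Operators

/-! ### Jacobi operators -/

/-- The canonical basis vectors of `ℓ²(ℕ)`. -/
def canonicalVector (k : ℕ) : L2Seq := lp.single 2 k (1 : ℂ)

/-- The second order difference expression with diagonal `q` and off-diagonal `b`. -/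
def jacobiExpr (q b : ℕ → ℝ) (φ : ℕ → ℂ) : ℕ → ℂ
  | 0 => q 0 * φ 0 + b 0 * φ 1
  | k + 1 => b k * φ k + q (k + 1) * φ (k + 1) + b (k + 1) * φ (k + 2)

/-- The space of sequences with finitely many nonzero elements. -/
def finSeq : Submodule ℂ L2Seq where
  carrier := {φ | {k | φ k ≠ 0}.Finite}
  zero_mem' := by simp
  add_mem' := by
    intro φ ψ hφ hψ
    refine (Set.Finite.union hφ hψ).subset fun k hk => ?_
    by_contra hc
    simp only [Set.mem_union, not_or, Set.mem_ofPred_eq, not_not] at hc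
    exact hk (by simp [hc.1, hc.2])
  smul_mem' := by
    intro c φ hφ
    exact Set.Finite.subset hφ fun k hk hc => hk (by simp [hc])

theorem memlp_jacobiExpr (q b : ℕ → ℝ) (φ : finSeq) :
    Memℓp (jacobiExpr q b (φ : L2Seq)) 2 := by
  have h0 : Memℓp (jacobiExpr q b (φ : L2Seq)) 0 := by
    refine memℓp_zero ?_
    obtain ⟨N, hN⟩ := Set.Finite.bddAbove φ.2
    refine (Set.finite_Iic (N + 1)).subset fun k hk => ?_
    by_contra hc
    have hz : ∀ j, N < j → (φ : L2Seq) j = 0 := by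
      intro j hj
      by_contra hne
      exact absurd (hN hne) (by omega)
    simp only [Set.mem_Iic, not_le] at hc
    obtain ⟨m, rfl⟩ : ∃ m, k = m + 1 := ⟨k - 1, by omega⟩
    exact hk (by simp [jacobiExpr, hz m (by omega), hz (m + 1) (by omega), hz (m + 2) (by omega)])
  exact h0.of_exponent_ge bot_le

/-- The operator `J₀`: the difference expression on the finitely supported sequences. -/
def jacobiPre (q b : ℕ → ℝ) : L2Seq →ₗ.[ℂ] L2Seq where
  domain := finSeq
  toFun :=
    { toFun := fun φ => ⟨jacobiExpr q b (φ : L2Seq), memlp_jacobiExpr q b φ⟩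
      map_add' := by
        intro φ ψ
        ext k
        change jacobiExpr q b (fun j => (φ : L2Seq) j + (ψ : L2Seq) j) k
          = jacobiExpr q b (φ : L2Seq) k + jacobiExpr q b (ψ : L2Seq) k
        cases k <;> simp only [jacobiExpr] <;> ring
      map_smul' := by
        intro c φ
        ext k
        change jacobiExpr q b (fun j => c * (φ : L2Seq) j) k
          = c * jacobiExpr q b (φ : L2Seq) k
        cases k <;> simp only [jacobiExpr] <;> ring }

/-- The Jacobi operator `J`: the closure of `J₀`. -/
def jacobiOperator (q b : ℕ → ℝ) : L2Seq →ₗ.[ℂ] L2Seq := (jacobiPre q b).closure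

/-- The polynomials of the first kind generated by the Jacobi matrix, i.e. the solution of
`z π₁ = q₁ π₁ + b₁ π₂`, `z πₖ = bₖ₋₁ πₖ₋₁ + qₖ πₖ + bₖ πₖ₊₁` with `π₁ = 1`. -/
def firstKindPoly (q b : ℕ → ℝ) : ℕ → Polynomial ℝ
  | 0 => 1
  | 1 => Polynomial.C (b 0)⁻¹ * (Polynomial.X - Polynomial.C (q 0))
  | k + 2 => Polynomial.C (b (k + 1))⁻¹ *
      ((Polynomial.X - Polynomial.C (q (k + 1))) * firstKindPoly q b (k + 1)
        - Polynomial.C (b k) * firstKindPoly q b k)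

end

/-! A failure of selfadjointness means that the maximal operator `J*` is not symmetric. By Green's
formula the boundary form of `J*` is the limit of Wronskians, so there are `φ`, `ψ` in the maximal
domain whose Wronskian has a nonzero limit. Expanding a solution `u` of `τ u = z u + c δ₁` in terms
of `φ` and `ψ` bounds `‖u n‖` by `‖φ n‖ + ‖ψ n‖` times a sum over the preceding components, and
Grönwall's inequality turns this into domination of `u` by a fixed square summable sequence, locally
uniformly in `z`. Hence `π(z)` and the polynomials of the second kind are square summable, `π` is
entire as a locally uniform limit of its truncations, and variation of constants bounds `J - z`
from below. Finally `ker (J* - z)` is spanned by `π(z)`, and `⟪π(z), δ₁⟫ = 1` says that `δ₁` is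
complementary to `ran (J - z) = (ker (J* - conj z))ᗮ`. -/

/-! ### Adjoints and closures -/

section Adjoint

variable {𝕜 E F : Type*} [RCLike 𝕜] [NormedAddCommGroup E] [InnerProductSpace 𝕜 E]
  [NormedAddCommGroup F] [InnerProductSpace 𝕜 F]

theorem adjoint_topologicalClosure (g : Submodule 𝕜 (E × F)) :
    g.topologicalClosure.adjoint = g.adjoint := by
  ext x
  simp only [Submodule.mem_adjoint_iff]
  refine ⟨fun h a b hab => h a b (g.le_topologicalClosure hab), fun h a b hab => ?_⟩
  have hclosed : IsClosed {p : E × F | inner 𝕜 p.2 x.1 - inner 𝕜 p.1 x.2 = 0} :=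
    isClosed_eq (by fun_prop) continuous_const
  exact closure_minimal (fun p hp => h p.1 p.2 hp) hclosed hab

theorem adjoint_adjoint_eq_topologicalClosure [CompleteSpace E] [CompleteSpace F]
    (g : Submodule 𝕜 (E × F)) : g.adjoint.adjoint = g.topologicalClosure := by
  let e : WithLp 2 (E × F) ≃L[𝕜] E × F := WithLp.prodContinuousLinearEquiv 2 𝕜 E F
  let K : Submodule 𝕜 (WithLp 2 (E × F)) := g.comap e.toLinearEquiv.toLinearMap
  have mem_orthogonal_iff (y : E × F) : e.symm y ∈ Kᗮ ↔ (y.2, -y.1) ∈ g.adjoint := by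
    simp only [Submodule.mem_orthogonal, Submodule.mem_adjoint_iff, inner_neg_right, sub_neg_eq_add]
    refine ⟨fun h a b hab => ?_, fun h w hw => ?_⟩
    · simpa [WithLp.prod_inner_apply, e, add_comm] using h (e.symm (a, b)) (by simpa [K] using hab)
    · simpa [WithLp.prod_inner_apply, e, add_comm] using h (e w).1 (e w).2 hw
  have mem_closure_iff (x : E × F) :
      e.symm x ∈ K.topologicalClosure ↔ x ∈ g.topologicalClosure := by
    have hpre : (K : Set (WithLp 2 (E × F))) = e ⁻¹' g := rfl
    rw [← SetLike.mem_coe, ← SetLike.mem_coe, Submodule.topologicalClosure_coe,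
      Submodule.topologicalClosure_coe, hpre, ← e.preimage_closure, Set.mem_preimage,
      e.apply_symm_apply]
  ext x
  rw [← mem_closure_iff, ← Submodule.orthogonal_orthogonal_eq_closure, Submodule.mem_adjoint_iff,
    Submodule.mem_orthogonal]
  refine ⟨fun h y hy => ?_, fun h a b hab => ?_⟩
  · have := h _ _ ((mem_orthogonal_iff (e y)).1 (by simpa using hy))
    rw [inner_neg_left, ← neg_add', neg_eq_zero] at this
    simpa [WithLp.prod_inner_apply, e] using this
  · have := h (e.symm (-b, a)) ((mem_orthogonal_iff _).2 (by simpa using hab))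
    simp only [e, WithLp.prod_inner_apply, WithLp.prodContinuousLinearEquiv_symm_apply,
      inner_neg_left] at this
    linear_combination -this

theorem dense_domain_closure {T : E →ₗ.[𝕜] F} (hT : Dense (T.domain : Set E)) :
    Dense (T.closure.domain : Set E) :=
  hT.mono T.le_closure.1

theorem adjoint_closure [CompleteSpace E] {T : E →ₗ.[𝕜] F} (hT : Dense (T.domain : Set E))
    (hc : T.IsClosable) : T.closure.adjoint = T.adjoint := by
  apply LinearPMap.eq_of_eq_graph
  rw [LinearPMap.adjoint_graph_eq_graph_adjoint (dense_domain_closure hT),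
    LinearPMap.adjoint_graph_eq_graph_adjoint hT, ← hc.graph_closure_eq_closure_graph,
    adjoint_topologicalClosure]

end Adjoint

section Operators

variable {H : Type*} [NormedAddCommGroup H] [InnerProductSpace ℂ H]

theorem mem_kernelSub_iff {B : H →ₗ.[ℂ] H} {z : ℂ} {x : H} :
    x ∈ kernelSub B z ↔ (x, z • x) ∈ B.graph := by
  simp only [kernelSub, Submodule.mem_map, LinearMap.mem_ker, LinearMap.sub_apply,
    LinearMap.smul_apply, sub_eq_zero, LinearPMap.mem_graph_iff, Submodule.subtype_apply]
  exact exists_congr fun _ => ⟨fun ⟨h, hx⟩ => ⟨hx, hx ▸ h⟩, fun ⟨hx, h⟩ => ⟨hx ▸ h, hx⟩⟩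

theorem mem_rangeSub_iff {A : H →ₗ.[ℂ] H} {z : ℂ} {y : H} :
    y ∈ rangeSub A z ↔ ∃ p ∈ A.graph, p.2 - z • p.1 = y := by
  simp only [rangeSub, LinearMap.mem_range, LinearMap.sub_apply, LinearMap.smul_apply,
    LinearPMap.mem_graph_iff, Submodule.subtype_apply]
  constructor
  · rintro ⟨x, rfl⟩
    exact ⟨(x, A x), ⟨x, rfl, rfl⟩, rfl⟩
  · rintro ⟨_, ⟨x, hx, hAx⟩, rfl⟩
    exact ⟨x, by rw [← hx, ← hAx]; rfl⟩

/-! ### Symmetric operators -/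

namespace IsSymmetricOperator

variable [CompleteSpace H] {A : H →ₗ.[ℂ] H}

theorem le_adjoint (hA : IsSymmetricOperator A) : A ≤ A.adjoint :=
  hA.symmetric.le_adjoint hA.dense_domain

theorem isClosable (hA : IsSymmetricOperator A) : A.IsClosable :=
  (LinearPMap.adjoint_isClosed hA.dense_domain).isClosable.leIsClosable hA.le_adjoint

theorem closure_le_adjoint (hA : IsSymmetricOperator A) : A.closure ≤ A.adjoint := by
  rw [← LinearPMap.le_graph_iff, ← hA.isClosable.graph_closure_eq_closure_graph]
  exact Submodule.topologicalClosure_minimal _ (LinearPMap.le_graph_iff.2 hA.le_adjoint)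
    (LinearPMap.adjoint_isClosed hA.dense_domain)

theorem closure (hA : IsSymmetricOperator A) : IsSymmetricOperator A.closure where
  dense_domain := dense_domain_closure hA.dense_domain
  symmetric x y := by
    have hle : A.closure ≤ A.closure.adjoint := by
      rw [adjoint_closure hA.dense_domain hA.isClosable]
      exact hA.closure_le_adjoint
    rw [hle.2 (x := x) (y := ⟨x, hle.1 x.2⟩) rfl]
    exact LinearPMap.adjoint_isFormalAdjoint (dense_domain_closure hA.dense_domain) _ y

theorem isSelfAdjoint_closure (hA : IsSymmetricOperator A)
    (hsymm : A.adjoint.IsFormalAdjoint A.adjoint) : IsSelfAdjoint A.closure := by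
  rw [LinearPMap.isSelfAdjoint_def, adjoint_closure hA.dense_domain hA.isClosable]
  refine le_antisymm ?_ hA.closure_le_adjoint
  rw [← LinearPMap.le_graph_iff, ← hA.isClosable.graph_closure_eq_closure_graph,
    ← adjoint_adjoint_eq_topologicalClosure,
    ← LinearPMap.adjoint_graph_eq_graph_adjoint hA.dense_domain]
  intro p hp
  obtain ⟨u, hu⟩ := (LinearPMap.mem_graph_iff' _).1 hp
  subst hu
  refine (Submodule.mem_adjoint_iff _ _).2 fun a b hab => ?_
  obtain ⟨v, rfl, rfl⟩ := (LinearPMap.mem_graph_iff _).1 hab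
  exact sub_eq_zero.2 (hsymm v u)

end IsSymmetricOperator

/-! ### Regular operators and gauges -/

theorem orthogonal_rangeSub [CompleteSpace H] {A : H →ₗ.[ℂ] H} (hA : Dense (A.domain : Set H))
    (z : ℂ) : (rangeSub A z)ᗮ = kernelSub A.adjoint (conj z) := by
  ext x
  simp only [mem_kernelSub_iff, LinearPMap.adjoint_graph_eq_graph_adjoint hA,
    Submodule.mem_adjoint_iff, Submodule.mem_orthogonal, mem_rangeSub_iff, Prod.exists,
    forall_exists_index, and_imp]
  constructor
  · intro h a b hab
    simpa [inner_sub_left, inner_smul_left, inner_smul_right] using h _ a b hab rfl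
  · rintro h _ a b hab rfl
    simpa [inner_sub_left, inner_smul_left, inner_smul_right] using h a b hab

theorem isRegularOperator_closure {A : H →ₗ.[ℂ] H} (hA : A.IsClosable)
    (hbound : ∀ z : ℂ, ∃ K : ℝ, ∀ φ : A.domain, ‖(φ : H)‖ ≤ K * ‖A φ - z • (φ : H)‖) :
    IsRegularOperator A.closure where
  isClosed := hA.closure_isClosed
  bounded_below z := by
    obtain ⟨K, hK⟩ := hbound z
    have hclosed : IsClosed {p : H × H | ‖p.1‖ ≤ K * ‖p.2 - z • p.1‖} :=
      isClosed_le (by fun_prop) (by fun_prop)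
    have hgraph : (A.graph : Set (H × H)) ⊆ {p | ‖p.1‖ ≤ K * ‖p.2 - z • p.1‖} := by
      intro p hp
      obtain ⟨φ, rfl⟩ := (LinearPMap.mem_graph_iff' _).1 hp
      exact hK φ
    refine ⟨(max K 1)⁻¹, by positivity, fun φ => ?_⟩
    have hφ : ((φ : H), A.closure φ) ∈ _root_.closure (A.graph : Set (H × H)) := by
      rw [← Submodule.topologicalClosure_coe, hA.graph_closure_eq_closure_graph]
      exact A.closure.mem_graph φ
    rw [inv_mul_le_iff₀ (by positivity)]
    exact (closure_minimal hgraph hclosed hφ).trans (by gcongr; exact le_max_left K 1)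

theorem IsRegularOperator.isClosed_rangeSub [CompleteSpace H] {A : H →ₗ.[ℂ] H}
    (hA : IsRegularOperator A) (z : ℂ) : IsClosed (rangeSub A z : Set H) := by
  obtain ⟨C, hC, hbound⟩ := hA.bounded_below z
  have : CompleteSpace A.graph := (IsClosed.isComplete hA.isClosed).completeSpace_coe
  let f : A.graph →L[ℂ] H :=
    (ContinuousLinearMap.snd ℂ H H - z • ContinuousLinearMap.fst ℂ H H).comp A.graph.subtypeL
  have hrange : (rangeSub A z : Set H) = Set.range f := by
    ext y
    simp [mem_rangeSub_iff, f]
  have hfst (p : A.graph) : ‖(p : H × H).1‖ ≤ C⁻¹ * ‖f p‖ := by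
    obtain ⟨φ, hφ⟩ := (LinearPMap.mem_graph_iff' _).1 p.2
    rw [le_inv_mul_iff₀ hC]
    simpa [f, ← hφ] using hbound φ
  have hsnd (p : A.graph) : ‖(p : H × H).2‖ ≤ ‖f p‖ + ‖z‖ * ‖(p : H × H).1‖ := by
    have : (p : H × H).2 = f p + z • (p : H × H).1 := by simp [f]
    rw [this, ← norm_smul]
    exact norm_add_le _ _
  have hanti : AntilipschitzWith (Real.toNNReal (C⁻¹ + (1 + ‖z‖ * C⁻¹))) f := by
    refine AddMonoidHomClass.antilipschitz_of_bound f fun p => ?_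
    rw [Real.coe_toNNReal _ (by positivity), Submodule.coe_norm, Prod.norm_def]
    have hz : ‖z‖ * ‖(p : H × H).1‖ ≤ ‖z‖ * (C⁻¹ * ‖f p‖) := by gcongr; exact hfst p
    refine max_le ((hfst p).trans ?_) ((hsnd p).trans ?_)
    · gcongr
      exact le_add_of_nonneg_right (by positivity)
    · have : 0 ≤ C⁻¹ * ‖f p‖ := by positivity
      linarith
  exact hrange ▸ hanti.isClosed_range f.uniformContinuous

theorem isCompl_orthogonal_span_singleton {v μ : H} (h : ⟪v, μ⟫_ℂ ≠ 0) :
    IsCompl (Submodule.span ℂ {v})ᗮ (Submodule.span ℂ {μ}) := by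
  refine ⟨Submodule.disjoint_def.2 fun x hx hxμ => ?_, codisjoint_iff.2 ?_⟩
  · obtain ⟨c, rfl⟩ := Submodule.mem_span_singleton.1 hxμ
    rw [Submodule.mem_orthogonal_singleton_iff_inner_right, inner_smul_right] at hx
    rw [(mul_eq_zero.1 hx).resolve_right h, zero_smul]
  · refine Submodule.eq_top_iff'.2 fun x => Submodule.mem_sup.2
      ⟨x - (⟪v, x⟫_ℂ / ⟪v, μ⟫_ℂ) • μ, ?_, _,
        Submodule.smul_mem _ _ (Submodule.mem_span_singleton_self μ), sub_add_cancel _ _⟩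
    rw [Submodule.mem_orthogonal_singleton_iff_inner_right, inner_sub_right, inner_smul_right,
      div_mul_cancel₀ _ h, sub_self]

theorem isEntireGauge_iff {A : H →ₗ.[ℂ] H} {μ : H} :
    IsEntireGauge A μ ↔ ∀ z, IsCompl (rangeSub A z) (Submodule.span ℂ {μ}) := by
  have hempty : exceptionalSet A μ = ∅ ↔ ∀ z, IsCompl (rangeSub A z) (Submodule.span ℂ {μ}) := by
    simp [exceptionalSet, Set.eq_empty_iff_forall_notMem]
  rw [← hempty]
  refine ⟨And.right, fun h => ⟨?_, h⟩⟩
  rw [IsGauge, h]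
  exact Set.countable_empty

theorem IsRegularOperator.isEntireGauge [CompleteSpace H] {A : H →ₗ.[ℂ] H}
    (hA : IsRegularOperator A) (hdense : Dense (A.domain : Set H)) {ξ : ℂ → H} {μ : H}
    (hker : ∀ z, kernelSub A.adjoint z = Submodule.span ℂ {ξ z}) (hμ : ∀ z, ⟪ξ z, μ⟫_ℂ ≠ 0) :
    IsEntireGauge A μ := by
  refine isEntireGauge_iff.2 fun z => ?_
  have hrange : rangeSub A z = (Submodule.span ℂ {ξ (conj z)})ᗮ := by
    rw [← hker, ← orthogonal_rangeSub hdense, Submodule.orthogonal_orthogonal_eq_closure,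
      (hA.isClosed_rangeSub z).submodule_topologicalClosure_eq]
  exact hrange ▸ isCompl_orthogonal_span_singleton (hμ (conj z))

theorem CommutesWith.closure {I : H → H} {A : H →ₗ.[ℂ] H} (h : CommutesWith I A)
    (hI : Continuous I) (hA : A.IsClosable) : CommutesWith I A.closure := by
  have hmaps : Set.MapsTo (Prod.map I I) (_root_.closure (A.graph : Set (H × H)))
      (_root_.closure (A.graph : Set (H × H))) := by
    refine Set.MapsTo.closure (fun p hp => ?_) (hI.prodMap hI)
    obtain ⟨φ, rfl⟩ := (LinearPMap.mem_graph_iff' _).1 hp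
    obtain ⟨hmem, hAI⟩ := h φ
    exact (LinearPMap.mem_graph_iff _).2 ⟨⟨I φ, hmem⟩, rfl, hAI⟩
  rw [← Submodule.topologicalClosure_coe, hA.graph_closure_eq_closure_graph] at hmaps
  intro φ
  obtain ⟨ψ, hψ, hAψ⟩ := (LinearPMap.mem_graph_iff _).1 (hmaps (A.closure.mem_graph φ))
  have hψ : (ψ : H) = I φ := hψ
  have hmem : I φ ∈ A.closure.domain := hψ ▸ ψ.2
  exact ⟨hmem, (congrArg A.closure (Subtype.ext hψ.symm : ⟨I φ, hmem⟩ = ψ)).trans hAψ⟩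

end Operators

/-! ### Sequence spaces -/

section SequenceSpaces

open Filter Topology

variable {ι : Type*}

theorem norm_sum_mul_le_norm_mul_norm {𝕜 : Type*} [NormedRing 𝕜] {p q : ENNReal}
    (hpq : p.toReal.HolderConjugate q.toReal) (f : lp (fun _ : ι => 𝕜) p)
    (g : lp (fun _ : ι => 𝕜) q) (s : Finset ι) : ‖∑ i ∈ s, f i * g i‖ ≤ ‖f‖ * ‖g‖ :=
  calc ‖∑ i ∈ s, f i * g i‖
    _ ≤ ∑ i ∈ s, ‖f i‖ * ‖g i‖ := norm_sum_le_of_le _ fun i _ => norm_mul_le _ _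
    _ ≤ ∑' i, ‖f i‖ * ‖g i‖ :=
      (lp.summable_mul hpq f g).sum_le_tsum s fun i _ => by positivity
    _ ≤ ‖f‖ * ‖g‖ := lp.tsum_mul_le_mul_norm' hpq f g

theorem lp_sum_single_apply [DecidableEq ι] {E : ι → Type*} [∀ i, NormedAddCommGroup (E i)]
    (p : ENNReal) (s : Finset ι) (f : ∀ i, E i) (j : ι) :
    (∑ i ∈ s, lp.single p i (f i)) j = if j ∈ s then f j else 0 := by
  rw [lp.coeFn_sum, Finset.sum_apply]
  simp only [lp.coeFn_single]
  exact Finset.sum_pi_single j f s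

theorem tendstoUniformlyOn_sum_lp_single {α : Type*} [DecidableEq ι] {E : ι → Type*}
    [∀ i, NormedAddCommGroup (E i)] {p : ENNReal} [Fact (1 ≤ p)] (hp : p ≠ ⊤)
    {U : Set α} {f : α → lp E p} (h : lp (fun _ : ι => ℝ) p) (hf : ∀ z ∈ U, ∀ i, ‖f z i‖ ≤ ‖h i‖) :
    TendstoUniformlyOn (fun s z => ∑ i ∈ s, lp.single p i (f z i)) f atTop U := by
  have hp0 : p ≠ 0 := (zero_lt_one.trans_le (Fact.out : 1 ≤ p)).ne'
  refine Metric.tendstoUniformlyOn_iff.2 fun ε hε => ?_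
  filter_upwards [Metric.tendsto_nhds.1 (lp.hasSum_single hp h) ε hε] with s hs z hz
  rw [dist_comm, dist_eq_norm] at *
  refine (lp.norm_mono hp0 fun i => ?_).trans_lt hs
  simp only [lp.coeFn_sub, Pi.sub_apply, lp_sum_single_apply]
  split_ifs
  · simp
  · simpa using hf z hz i

theorem differentiableOn_lp_of_dominated {E : ι → Type*} [∀ i, NormedAddCommGroup (E i)]
    [∀ i, NormedSpace ℂ (E i)] [∀ i, CompleteSpace (E i)] {p : ENNReal} [Fact (1 ≤ p)]
    (hp : p ≠ ⊤) {U : Set ℂ} (hU : IsOpen U) {f : ℂ → lp E p}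
    (hdiff : ∀ i, DifferentiableOn ℂ (fun z => f z i) U) (h : lp (fun _ : ι => ℝ) p)
    (hf : ∀ z ∈ U, ∀ i, ‖f z i‖ ≤ ‖h i‖) : DifferentiableOn ℂ f U := by
  classical
  refine (tendstoUniformlyOn_sum_lp_single hp h hf).tendstoLocallyUniformlyOn.differentiableOn
    (Eventually.of_forall fun s => ?_) hU
  exact DifferentiableOn.fun_sum fun i _ =>
    (lp.singleContinuousLinearMap ℂ E p i).differentiable.comp_differentiableOn (hdiff i)

theorem isConjugation_star : IsConjugation fun φ : lp (fun _ : ι => ℂ) 2 => star φ where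
  map_add := star_add
  map_smul := star_smul
  involutive := star_star
  inner_map φ ψ := by
    rw [lp.inner_eq_tsum, lp.inner_eq_tsum]
    refine tsum_congr fun i => ?_
    simp [mul_comm]

end SequenceSpaces

/-! ### The difference equation -/

section DifferenceEquation

open Filter Topology

/-- The Wronskian `Wₙ(u, v) = bₙ (uₙ vₙ₊₁ - uₙ₊₁ vₙ)` of two sequences, which is the boundary term
in Green's formula for the difference expression. -/
def wronskian (b : ℕ → ℝ) (u v : ℕ → ℂ) (n : ℕ) : ℂ :=
  b n * (u n * v (n + 1) - u (n + 1) * v n)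

/-- The sequence `u` solves the inhomogeneous equation `τ u = z u + c δ₁`, where `τ` is the
difference expression. Taking `c = 0` gives the formal eigenvectors, and `c = 1`, `u 0 = 0` the
polynomials of the second kind. -/
def IsJacobiSolution (q b : ℕ → ℝ) (z c : ℂ) (u : ℕ → ℂ) : Prop :=
  ∀ k, jacobiExpr q b u k = z * u k + if k = 0 then c else 0

theorem sum_jacobiExpr_eq_wronskian (q b : ℕ → ℝ) (u v : ℕ → ℂ) (n : ℕ) :
    ∑ k ∈ Finset.range (n + 1), (u k * jacobiExpr q b v k - jacobiExpr q b u k * v k) =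
      wronskian b u v n := by
  induction n with
  | zero => simp only [zero_add, Finset.sum_range_one, jacobiExpr, wronskian]; ring
  | succ n ih => rw [Finset.sum_range_succ, ih]; simp only [jacobiExpr, wronskian]; ring

theorem mul_wronskian (b : ℕ → ℝ) (u v w : ℕ → ℂ) (n : ℕ) :
    u n * wronskian b v w n = w n * wronskian b v u n - v n * wronskian b w u n := by
  simp only [wronskian]; ring

theorem succ_mul_wronskian (b : ℕ → ℝ) (u v w : ℕ → ℂ) (n : ℕ) :
    u (n + 1) * wronskian b v w n =
      v (n + 1) * wronskian b u w n - w (n + 1) * wronskian b u v n := by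
  simp only [wronskian]; ring

theorem jacobiExpr_star (q b : ℕ → ℝ) (φ : ℕ → ℂ) :
    jacobiExpr q b (star φ) = star (jacobiExpr q b φ) := by
  ext k
  cases k <;> simp [jacobiExpr]

namespace IsJacobiSolution

variable {q b : ℕ → ℝ} {z c : ℂ} {u v : ℕ → ℂ}

theorem wronskian_eq (hu : IsJacobiSolution q b z c u) (v : ℕ → ℂ) (n : ℕ) :
    wronskian b u v n =
      ∑ k ∈ Finset.range (n + 1), u k * (jacobiExpr q b v k - z * v k) - c * v 0 := by
  have hc : ∑ k ∈ Finset.range (n + 1), (if k = 0 then c else 0) * v k = c * v 0 := by simp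
  rw [← sum_jacobiExpr_eq_wronskian q, ← hc, ← Finset.sum_sub_distrib]
  refine Finset.sum_congr rfl fun k _ => ?_
  rw [hu k]
  ring

theorem wronskian_eq_of_isJacobiSolution {c' : ℂ} (hu : IsJacobiSolution q b z c u)
    (hv : IsJacobiSolution q b z c' v) (n : ℕ) : wronskian b u v n = c' * u 0 - c * v 0 := by
  simp [hu.wronskian_eq, hv _, mul_comm]

theorem const_mul (hu : IsJacobiSolution q b z c u) (a : ℂ) :
    IsJacobiSolution q b z (a * c) fun k => a * u k := by
  intro k
  have : jacobiExpr q b (fun k => a * u k) k = a * jacobiExpr q b u k := by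
    cases k <;> simp only [jacobiExpr] <;> ring
  rw [this, hu k, mul_add, mul_ite, mul_zero]
  ring

protected theorem ext (hb : ∀ k, b k ≠ 0) (hu : IsJacobiSolution q b z c u)
    (hv : IsJacobiSolution q b z c v) (h₀ : u 0 = v 0) : u = v := by
  suffices h : ∀ n, u n = v n ∧ u (n + 1) = v (n + 1) from funext fun n => (h n).1
  intro n
  induction n with
  | zero =>
    have hexpr := (hu 0).trans (h₀ ▸ (hv 0).symm)
    simp only [jacobiExpr, h₀, add_right_inj] at hexpr
    exact ⟨h₀, mul_left_cancel₀ (Complex.ofReal_ne_zero.2 (hb 0)) hexpr⟩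
  | succ n ih =>
    have hexpr := (hu (n + 1)).trans (ih.2 ▸ (hv (n + 1)).symm)
    simp only [jacobiExpr, ih.1, ih.2, add_right_inj] at hexpr
    exact ⟨ih.2, mul_left_cancel₀ (Complex.ofReal_ne_zero.2 (hb (n + 1))) hexpr⟩

end IsJacobiSolution

/-! ### Polynomials of the first and second kind -/

/-- The polynomials of the second kind, the solution of `τ u = z u + δ₁` vanishing at the first
index. They are the polynomials of the first kind of the shifted coefficients, divided by `b 0`. -/
noncomputable def secondKindPoly (q b : ℕ → ℝ) : ℕ → Polynomial ℝ
  | 0 => 0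
  | k + 1 => Polynomial.C (b 0)⁻¹ * firstKindPoly (fun j => q (j + 1)) (fun j => b (j + 1)) k

variable {q b : ℕ → ℝ}

theorem isJacobiSolution_firstKindPoly (hb : ∀ k, b k ≠ 0) (z : ℂ) :
    IsJacobiSolution q b z 0 fun k => Polynomial.aeval z (firstKindPoly q b k) := by
  have hb' (k : ℕ) : (b k : ℂ) ≠ 0 := Complex.ofReal_ne_zero.2 (hb k)
  rintro (_ | k)
  · simp [jacobiExpr, firstKindPoly, mul_inv_cancel_left₀ (hb' _)]
  · simp only [jacobiExpr, firstKindPoly, map_mul, map_sub, Polynomial.aeval_C, Polynomial.aeval_X,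
      Complex.coe_algebraMap, Complex.ofReal_inv, mul_inv_cancel_left₀ (hb' _), k.succ_ne_zero,
      if_false]
    ring

theorem isJacobiSolution_secondKindPoly (hb : ∀ k, b k ≠ 0) (z : ℂ) :
    IsJacobiSolution q b z 1 fun k => Polynomial.aeval z (secondKindPoly q b k) := by
  have hb₀ : (b 0 : ℂ) ≠ 0 := Complex.ofReal_ne_zero.2 (hb 0)
  have hshift := isJacobiSolution_firstKindPoly (q := fun j => q (j + 1)) (fun k => hb (k + 1)) z
  rintro (_ | _ | k)
  · simp [jacobiExpr, secondKindPoly, firstKindPoly, hb₀]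
  · have hzero := hshift 0
    simp only [jacobiExpr, ite_self] at hzero
    simp only [jacobiExpr, secondKindPoly, map_zero, map_mul, Polynomial.aeval_C,
      Complex.coe_algebraMap, Complex.ofReal_inv, Nat.succ_ne_zero, if_false]
    linear_combination (b 0 : ℂ)⁻¹ * hzero
  · have hsucc := hshift (k + 1)
    simp only [jacobiExpr, ite_self] at hsucc
    simp only [jacobiExpr, secondKindPoly, map_mul, Polynomial.aeval_C, Complex.coe_algebraMap,
      Complex.ofReal_inv, Nat.succ_ne_zero, if_false]
    linear_combination (b 0 : ℂ)⁻¹ * hsucc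

theorem IsJacobiSolution.eq_mul_firstKindPoly {z : ℂ} {u : ℕ → ℂ}
    (hu : IsJacobiSolution q b z 0 u) (hb : ∀ k, b k ≠ 0) (k : ℕ) :
    u k = u 0 * Polynomial.aeval z (firstKindPoly q b k) := by
  have hπ := (isJacobiSolution_firstKindPoly (q := q) hb z).const_mul (u 0)
  rw [mul_zero] at hπ
  exact congrFun (hu.ext hb hπ (by simp [firstKindPoly])) k

/-! ### Domination of solutions -/

/-- A componentwise upper bound of `(τ - z) φ`, where `τ` is the difference expression, which is
uniform over `‖z‖ ≤ R`. -/
noncomputable def residualMajorant (q b : ℕ → ℝ) (R : ℝ) (φ : ℕ → ℂ) (k : ℕ) : ℝ :=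
  ‖jacobiExpr q b φ k‖ + R * ‖φ k‖

theorem residualMajorant_nonneg {R : ℝ} (hR : 0 ≤ R) (φ : ℕ → ℂ) (k : ℕ) :
    0 ≤ residualMajorant q b R φ k := by
  unfold residualMajorant
  positivity

theorem IsJacobiSolution.norm_wronskian_le {R : ℝ} {z c : ℂ} {u : ℕ → ℂ}
    (hu : IsJacobiSolution q b z c u) (hz : ‖z‖ ≤ R) (φ : ℕ → ℂ) (n : ℕ) :
    ‖wronskian b u φ n‖ ≤
      ‖φ 0‖ * ‖c‖ + ∑ k ∈ Finset.range (n + 1), residualMajorant q b R φ k * ‖u k‖ := by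
  have hres (k : ℕ) : ‖jacobiExpr q b φ k - z * φ k‖ ≤ residualMajorant q b R φ k := by
    refine (norm_sub_le _ _).trans ?_
    rw [norm_mul, residualMajorant]
    gcongr
  rw [hu.wronskian_eq φ n, add_comm (‖φ 0‖ * ‖c‖), mul_comm ‖φ 0‖, ← norm_mul]
  refine (norm_sub_le _ _).trans (add_le_add_left (norm_sum_le_of_le _ fun k _ => ?_) _)
  rw [norm_mul, mul_comm]
  gcongr
  exact hres k

theorem IsJacobiSolution.norm_succ_mul_norm_wronskian_le {R : ℝ} {z c : ℂ} {u : ℕ → ℂ}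
    (hu : IsJacobiSolution q b z c u) (hz : ‖z‖ ≤ R) (φ ψ : ℕ → ℂ) (n : ℕ) :
    ‖u (n + 1)‖ * ‖wronskian b φ ψ n‖ ≤ (‖φ (n + 1)‖ + ‖ψ (n + 1)‖) *
      ((‖φ 0‖ + ‖ψ 0‖) * ‖c‖ + ∑ k ∈ Finset.range (n + 1),
        (residualMajorant q b R φ k + residualMajorant q b R ψ k) * ‖u k‖) := by
  have hφ := hu.norm_wronskian_le hz φ n
  have hψ := hu.norm_wronskian_le hz ψ n
  have hφ₀ : 0 ≤ ‖φ 0‖ * ‖c‖ + ∑ k ∈ Finset.range (n + 1), residualMajorant q b R φ k * ‖u k‖ :=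
    (norm_nonneg _).trans hφ
  have hψ₀ : 0 ≤ ‖ψ 0‖ * ‖c‖ + ∑ k ∈ Finset.range (n + 1), residualMajorant q b R ψ k * ‖u k‖ :=
    (norm_nonneg _).trans hψ
  rw [← norm_mul, succ_mul_wronskian]
  simp only [add_mul, Finset.sum_add_distrib]
  refine (norm_sub_le _ _).trans ?_
  rw [norm_mul, norm_mul]
  gcongr <;> linarith

theorem le_mul_exp_of_le_mul_sum {a g h : ℕ → ℝ} {K : ℝ} {N : ℕ} (ha : 0 ≤ a) (hg : 0 ≤ g)
    (hh : 0 ≤ h) (hK : 0 ≤ K) (hgh : Summable fun k => g k * h k)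
    (hrec : ∀ n ≥ N, a n ≤ h n * (K + ∑ k ∈ Finset.range n, g k * a k)) {n : ℕ} (hn : N ≤ n) :
    a n ≤ h n * ((K + ∑ k ∈ Finset.range N, g k * a k) * Real.exp (∑' k, g k * h k)) := by
  have hstart : 0 ≤ K + ∑ k ∈ Finset.range N, g k * a k :=
    add_nonneg hK (Finset.sum_nonneg fun k _ => mul_nonneg (hg k) (ha k))
  have hpartial : K + ∑ k ∈ Finset.range n, g k * a k ≤
      (K + ∑ k ∈ Finset.range N, g k * a k) * Real.exp (∑ k ∈ Finset.Ico N n, g k * h k) := by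
    simpa using discrete_gronwall (u := fun n => K + ∑ k ∈ Finset.range n, g k * a k) (b := 0)
      hstart (fun m hm => by
        have := mul_le_mul_of_nonneg_left (hrec m hm) (hg m)
        rw [Finset.sum_range_succ, Pi.zero_apply]
        linarith)
      (fun m _ => mul_nonneg (hg m) (hh m)) (fun _ _ => le_rfl) hn
  refine (hrec n hn).trans (mul_le_mul_of_nonneg_left (hpartial.trans ?_) (hh n))
  have hsum : ∑ k ∈ Finset.Ico N n, g k * h k ≤ ∑' k, g k * h k :=
    hgh.sum_le_tsum _ fun k _ => mul_nonneg (hg k) (hh k)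
  gcongr

/-- The domain of the maximal operator: square summable sequences whose image under the
difference expression is square summable. -/
structure MemMaximalDomain (q b : ℕ → ℝ) (φ : ℕ → ℂ) : Prop where
  memℓp : Memℓp φ 2
  memℓp_jacobiExpr : Memℓp (jacobiExpr q b φ) 2

theorem MemMaximalDomain.star {φ : ℕ → ℂ} (hφ : MemMaximalDomain q b φ) :
    MemMaximalDomain q b (star φ) :=
  ⟨hφ.memℓp.star_mem, jacobiExpr_star q b φ ▸ hφ.memℓp_jacobiExpr.star_mem⟩

theorem MemMaximalDomain.memℓp_residualMajorant {φ : ℕ → ℂ} (hφ : MemMaximalDomain q b φ) (R : ℝ) :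
    Memℓp (residualMajorant q b R φ) 2 :=
  hφ.memℓp_jacobiExpr.norm.add (hφ.memℓp.norm.const_mul R)

theorem holderConjugate_toReal_two : (2 : ENNReal).toReal.HolderConjugate (2 : ENNReal).toReal := by
  rw [ENNReal.toReal_ofNat]
  exact Real.HolderConjugate.two_two

theorem summable_mul_of_memℓp_two {ι : Type*} {f g : ι → ℝ} (hf : Memℓp f 2) (hg : Memℓp g 2) :
    Summable fun i => f i * g i := by
  refine Summable.of_norm ?_
  simpa only [norm_mul] using lp.summable_mul holderConjugate_toReal_two ⟨f, hf⟩ ⟨g, hg⟩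

theorem exists_norm_le_mul_of_le_norm_wronskian {φ ψ : ℕ → ℂ} (hφ : MemMaximalDomain q b φ)
    (hψ : MemMaximalDomain q b ψ) {δ : ℝ} (hδ : 0 < δ) {N : ℕ}
    (hW : ∀ n ≥ N, δ ≤ ‖wronskian b φ ψ n‖) (R : ℝ) :
    ∃ M, ∀ z c u, IsJacobiSolution q b z c u → ‖z‖ ≤ R → ∀ S, ‖c‖ ≤ S → (∀ k ≤ N, ‖u k‖ ≤ S) →
      ∀ n > N, ‖u n‖ ≤ (‖φ n‖ + ‖ψ n‖) * (M * S) := by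
  set h : ℕ → ℝ := fun n => δ⁻¹ * (‖φ n‖ + ‖ψ n‖) with h_def
  set g : ℕ → ℝ := residualMajorant q b R φ + residualMajorant q b R ψ
  have hgh : Summable fun k => g k * h k := summable_mul_of_memℓp_two
    ((hφ.memℓp_residualMajorant R).add (hψ.memℓp_residualMajorant R))
    ((hφ.memℓp.norm.add hψ.memℓp.norm).const_mul δ⁻¹)
  refine ⟨δ⁻¹ * (‖φ 0‖ + ‖ψ 0‖ + ∑ k ∈ Finset.range (N + 1), g k) * Real.exp (∑' k, g k * h k),
    fun z c u hu hz S hc hS n hn => ?_⟩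
  have hR : 0 ≤ R := (norm_nonneg z).trans hz
  have hg (k : ℕ) : 0 ≤ g k :=
    add_nonneg (residualMajorant_nonneg hR φ k) (residualMajorant_nonneg hR ψ k)
  have hrec : ∀ m ≥ N + 1, ‖u m‖ ≤
      h m * ((‖φ 0‖ + ‖ψ 0‖) * ‖c‖ + ∑ k ∈ Finset.range m, g k * ‖u k‖) := by
    intro m hm
    obtain ⟨m, rfl⟩ := Nat.exists_eq_succ_of_ne_zero (by omega : m ≠ 0)
    rw [h_def, mul_assoc, le_inv_mul_iff₀' hδ]
    exact (mul_le_mul_of_nonneg_left (hW m (by omega)) (norm_nonneg _)).trans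
      (hu.norm_succ_mul_norm_wronskian_le hz φ ψ m)
  have hinit : (‖φ 0‖ + ‖ψ 0‖) * ‖c‖ + ∑ k ∈ Finset.range (N + 1), g k * ‖u k‖ ≤
      (‖φ 0‖ + ‖ψ 0‖ + ∑ k ∈ Finset.range (N + 1), g k) * S := by
    rw [add_mul _ _ S, Finset.sum_mul]
    gcongr with k hk
    · exact hg k
    · exact hS k (by simpa [Nat.lt_succ_iff] using hk)
  calc ‖u n‖
    _ ≤ h n * (((‖φ 0‖ + ‖ψ 0‖) * ‖c‖ + ∑ k ∈ Finset.range (N + 1), g k * ‖u k‖) *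
        Real.exp (∑' k, g k * h k)) :=
      le_mul_exp_of_le_mul_sum (fun k => norm_nonneg (u k)) hg (fun k => by positivity)
        (by positivity) hgh hrec hn
    _ ≤ h n * ((‖φ 0‖ + ‖ψ 0‖ + ∑ k ∈ Finset.range (N + 1), g k) * S *
        Real.exp (∑' k, g k * h k)) := by gcongr
    _ = _ := by rw [h_def]; ring

theorem exists_dominating_sequence {φ ψ : ℕ → ℂ} (hφ : MemMaximalDomain q b φ)
    (hψ : MemMaximalDomain q b ψ) {L : ℂ} (hL : L ≠ 0)
    (hW : Tendsto (wronskian b φ ψ) atTop (𝓝 L)) :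
    ∃ N, ∀ R S, ∃ h : ℕ → ℝ, Memℓp h 2 ∧ ∀ z c u, IsJacobiSolution q b z c u → ‖z‖ ≤ R →
      ‖c‖ ≤ S → (∀ k ≤ N, ‖u k‖ ≤ S) → ∀ n, ‖u n‖ ≤ h n := by
  have hδ : 0 < ‖L‖ / 2 := by positivity
  obtain ⟨N, hN⟩ := eventually_atTop.1
    (hW.norm.eventually_const_le (half_lt_self (norm_pos_iff.2 hL)))
  refine ⟨N, fun R S => ?_⟩
  obtain ⟨M, hM⟩ := exists_norm_le_mul_of_le_norm_wronskian hφ hψ hδ hN R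
  have hfinite : Memℓp (fun n => if n ≤ N then S else 0) 2 := by
    refine (memℓp_zero ?_).of_exponent_ge bot_le
    exact (Set.finite_Iic N).subset fun n hn => (ite_ne_right_iff.1 hn).1
  refine ⟨_, hfinite.add ((hφ.memℓp.norm.add hψ.memℓp.norm).const_mul |M * S|),
    fun z c u hu hz hc hS n => ?_⟩
  simp only [Pi.add_apply]
  rcases le_or_gt n N with hn | hn
  · simpa [hn] using (hS n hn).trans (le_add_of_nonneg_right (by positivity))
  · rw [if_neg hn.not_ge, zero_add, mul_comm]
    exact (hM z c u hu hz S hc hS n hn).trans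
      (mul_le_mul_of_nonneg_left (le_abs_self (M * S)) (by positivity))

end DifferenceEquation

/-! ### The Jacobi operator and its adjoint -/

section JacobiOperator

open Filter Topology

variable {q b : ℕ → ℝ}

theorem mem_finSeq_iff {φ : L2Seq} : φ ∈ finSeq ↔ ∃ N, ∀ n ≥ N, φ n = 0 := by
  refine ⟨fun hφ => ?_, fun ⟨N, hN⟩ => (Set.finite_Iio N).subset fun n hn => ?_⟩
  · obtain ⟨N, hN⟩ := Set.Finite.bddAbove hφ
    exact ⟨N + 1, fun n hn => by_contra fun hne => absurd (hN hne) (by omega)⟩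
  · exact not_le.1 fun hle => hn (hN n hle)

theorem canonicalVector_mem_finSeq (k : ℕ) : canonicalVector k ∈ finSeq := by
  refine mem_finSeq_iff.2 ⟨k + 1, fun n hn => ?_⟩
  simp [canonicalVector, Nat.ne_of_gt hn]

theorem dense_finSeq : Dense (finSeq : Set L2Seq) := by
  intro φ
  refine mem_closure_of_tendsto (lp.hasSum_single (by simp) φ)
    (Eventually.of_forall fun s => sum_mem fun i _ => ?_)
  have : lp.single 2 i (φ i) = φ i • canonicalVector i := by
    rw [canonicalVector, ← lp.single_smul, smul_eq_mul, mul_one]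
  exact this ▸ finSeq.smul_mem _ (canonicalVector_mem_finSeq i)

theorem coe_jacobiPre (φ : (jacobiPre q b).domain) :
    ⇑(jacobiPre q b φ) = jacobiExpr q b (φ : L2Seq) :=
  rfl

theorem inner_jacobiPre (φ : (jacobiPre q b).domain) (ψ : L2Seq) :
    ⟪jacobiPre q b φ, ψ⟫_ℂ = ∑' k, ⟪(φ : L2Seq) k, jacobiExpr q b ψ k⟫_ℂ := by
  obtain ⟨N, hN⟩ := mem_finSeq_iff.1 φ.2
  have hJN : ∀ n ≥ N + 1, jacobiPre q b φ n = 0 := by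
    intro n hn
    obtain ⟨n, rfl⟩ := Nat.exists_eq_succ_of_ne_zero (by omega : n ≠ 0)
    simp [coe_jacobiPre, jacobiExpr, hN n (by omega), hN (n + 1) (by omega), hN (n + 2) (by omega)]
  have hW : wronskian b (star ((φ : L2Seq) : ℕ → ℂ)) ψ N = 0 := by
    simp [wronskian, hN N le_rfl, hN (N + 1) (by omega)]
  rw [← sum_jacobiExpr_eq_wronskian q, Finset.sum_sub_distrib, sub_eq_zero, jacobiExpr_star] at hW
  rw [lp.inner_eq_tsum,
    tsum_eq_sum (s := Finset.range (N + 1)) fun n hn => by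
      rw [hJN n (by simpa using hn), inner_zero_left],
    tsum_eq_sum (s := Finset.range (N + 1)) fun n hn => by
      rw [hN n (by simp at hn; omega), inner_zero_left]]
  simpa [coe_jacobiPre, mul_comm] using hW.symm

theorem isSymmetricOperator_jacobiPre : IsSymmetricOperator (jacobiPre q b) where
  dense_domain := dense_finSeq
  symmetric φ ψ := by rw [inner_jacobiPre, lp.inner_eq_tsum]; rfl

theorem isSymmetricOperator_jacobiOperator : IsSymmetricOperator (jacobiOperator q b) :=
  isSymmetricOperator_jacobiPre.closure

theorem mem_graph_adjoint_jacobiPre {x : L2Seq × L2Seq} :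
    x ∈ (jacobiPre q b).adjoint.graph ↔ ⇑x.2 = jacobiExpr q b x.1 := by
  rw [LinearPMap.adjoint_graph_eq_graph_adjoint dense_finSeq, Submodule.mem_adjoint_iff]
  constructor
  · intro h
    ext k
    let e : (jacobiPre q b).domain := ⟨canonicalVector k, canonicalVector_mem_finSeq k⟩
    have := sub_eq_zero.1 (h _ _ ((jacobiPre q b).mem_graph e))
    rw [inner_jacobiPre, tsum_eq_single k fun j hj => by simp [e, canonicalVector, hj]] at this
    simpa [e, canonicalVector, lp.inner_single_left] using this.symm
  · rintro h _ _ hab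
    obtain ⟨φ, rfl, rfl⟩ := (LinearPMap.mem_graph_iff _).1 hab
    rw [inner_jacobiPre, lp.inner_eq_tsum, h, sub_self]

theorem coe_adjoint_jacobiPre (x : (jacobiPre q b).adjoint.domain) :
    ⇑((jacobiPre q b).adjoint x) = jacobiExpr q b (x : L2Seq) :=
  mem_graph_adjoint_jacobiPre.1 ((jacobiPre q b).adjoint.mem_graph x)

theorem memMaximalDomain_of_mem_domain_adjoint (x : (jacobiPre q b).adjoint.domain) :
    MemMaximalDomain q b (x : L2Seq) :=
  ⟨lp.memℓp _, coe_adjoint_jacobiPre x ▸ lp.memℓp _⟩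

theorem mem_kernelSub_adjoint_jacobiOperator {z : ℂ} {φ : L2Seq} :
    φ ∈ kernelSub (jacobiOperator q b).adjoint z ↔ IsJacobiSolution q b z 0 φ := by
  rw [mem_kernelSub_iff, jacobiOperator,
    adjoint_closure dense_finSeq isSymmetricOperator_jacobiPre.isClosable,
    mem_graph_adjoint_jacobiPre, eq_comm, funext_iff]
  simp [IsJacobiSolution]

theorem commutesWith_star_jacobiOperator :
    CommutesWith (fun φ : L2Seq => star φ) (jacobiOperator q b) := by
  refine CommutesWith.closure (fun φ => ?_) continuous_star isSymmetricOperator_jacobiPre.isClosable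
  obtain ⟨N, hN⟩ := mem_finSeq_iff.1 φ.2
  exact ⟨mem_finSeq_iff.2 ⟨N, fun n hn => by simp [hN n hn]⟩,
    Subtype.ext (jacobiExpr_star q b (φ : L2Seq))⟩

theorem tendsto_wronskian_star (x y : (jacobiPre q b).adjoint.domain) :
    Tendsto (wronskian b (star ((x : L2Seq) : ℕ → ℂ)) (y : L2Seq)) atTop
      (𝓝 (⟪(x : L2Seq), (jacobiPre q b).adjoint y⟫_ℂ -
        ⟪(jacobiPre q b).adjoint x, (y : L2Seq)⟫_ℂ)) := by
  have hleft : HasSum (fun k => ⟪(x : L2Seq) k, (jacobiPre q b).adjoint y k⟫_ℂ)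
      ⟪(x : L2Seq), (jacobiPre q b).adjoint y⟫_ℂ := lp.hasSum_inner _ _
  have hright : HasSum (fun k => ⟪(jacobiPre q b).adjoint x k, (y : L2Seq) k⟫_ℂ)
      ⟪(jacobiPre q b).adjoint x, (y : L2Seq)⟫_ℂ := lp.hasSum_inner _ _
  refine ((hleft.sub hright).tendsto_sum_nat.comp (tendsto_add_atTop_nat 1)).congr fun n => ?_
  rw [← sum_jacobiExpr_eq_wronskian q, jacobiExpr_star, Function.comp_apply]
  refine Finset.sum_congr rfl fun k _ => ?_
  simp [coe_adjoint_jacobiPre, mul_comm]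

theorem exists_tendsto_wronskian (hJ : ¬ IsSelfAdjoint (jacobiOperator q b)) :
    ∃ φ ψ, MemMaximalDomain q b φ ∧ MemMaximalDomain q b ψ ∧
      ∃ L ≠ 0, Tendsto (wronskian b φ ψ) atTop (𝓝 L) := by
  obtain ⟨x, y, hxy⟩ : ∃ x y : (jacobiPre q b).adjoint.domain,
      ⟪(jacobiPre q b).adjoint x, (y : L2Seq)⟫_ℂ ≠ ⟪(x : L2Seq), (jacobiPre q b).adjoint y⟫_ℂ := by
    by_contra! h
    exact hJ (isSymmetricOperator_jacobiPre.isSelfAdjoint_closure h)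
  exact ⟨_, _, (memMaximalDomain_of_mem_domain_adjoint x).star,
    memMaximalDomain_of_mem_domain_adjoint y, _, sub_ne_zero.2 hxy.symm, tendsto_wronskian_star x y⟩

/-! ### Square summable solutions -/

theorem IsJacobiSolution.norm_wronskian_le_of_mem_domain {z c : ℂ} {u : L2Seq}
    (hu : IsJacobiSolution q b z c u) (φ : (jacobiPre q b).domain) (n : ℕ) :
    ‖wronskian b u (φ : L2Seq) n‖ ≤ ‖u‖ * ‖jacobiPre q b φ - z • (φ : L2Seq)‖ := by
  obtain ⟨N, hN⟩ := mem_finSeq_iff.1 φ.2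
  let f : L2Seq := jacobiPre q b φ - z • (φ : L2Seq)
  have hW (m : ℕ) : wronskian b u (φ : L2Seq) m =
      ∑ k ∈ Finset.range (m + 1), u k * f k - c * (φ : L2Seq) 0 :=
    hu.wronskian_eq (φ : L2Seq) m
  have hvanish : wronskian b u (φ : L2Seq) (max n N) = 0 := by
    simp [wronskian, hN (max n N) (le_max_right n N),
      hN (max n N + 1) ((le_max_right n N).trans (Nat.le_succ _))]
  have htail : ∑ k ∈ Finset.Ico (n + 1) (max n N + 1), u k * f k =
      -wronskian b u (φ : L2Seq) n := by
    rw [Finset.sum_Ico_eq_sub _ (Nat.succ_le_succ (le_max_left n N))]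
    linear_combination hvanish - hW (max n N) + hW n
  rw [← norm_neg, ← htail]
  exact norm_sum_mul_le_norm_mul_norm holderConjugate_toReal_two u f _

/-- Variation of constants: `φ` is the combination of `u` and `v` whose coefficients are the
Wronskians of `φ` with `v` and `u`. -/
theorem norm_mul_norm_le_of_isJacobiSolution {z c c' : ℂ} {u v : L2Seq}
    (hu : IsJacobiSolution q b z c u) (hv : IsJacobiSolution q b z c' v)
    (φ : (jacobiPre q b).domain) :
    ‖c' * u 0 - c * v 0‖ * ‖(φ : L2Seq)‖ ≤
      2 * ‖u‖ * ‖v‖ * ‖jacobiPre q b φ - z • (φ : L2Seq)‖ := by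
  set r := ‖jacobiPre q b φ - z • (φ : L2Seq)‖
  let h : lp (fun _ : ℕ => ℝ) 2 := (‖u‖ * r) • lp.toNorm v + (‖v‖ * r) • lp.toNorm u
  have hle (n : ℕ) : ‖((c' * u 0 - c * v 0) • (φ : L2Seq)) n‖ ≤ ‖h n‖ := by
    have hφ : (c' * u 0 - c * v 0) * (φ : L2Seq) n =
        v n * wronskian b u (φ : L2Seq) n - u n * wronskian b v (φ : L2Seq) n := by
      rw [← mul_wronskian, hu.wronskian_eq_of_isJacobiSolution hv, mul_comm]
    calc ‖(c' * u 0 - c * v 0) * (φ : L2Seq) n‖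
      _ ≤ ‖v n‖ * (‖u‖ * r) + ‖u n‖ * (‖v‖ * r) := by
        rw [hφ]
        refine (norm_sub_le _ _).trans ?_
        rw [norm_mul, norm_mul]
        gcongr
        · exact hu.norm_wronskian_le_of_mem_domain φ n
        · exact hv.norm_wronskian_le_of_mem_domain φ n
      _ = h n := by
        have hn : h n = ‖u‖ * r * ‖v n‖ + ‖v‖ * r * ‖u n‖ := rfl
        rw [hn]
        ring
      _ ≤ ‖h n‖ := le_abs_self _
  calc ‖c' * u 0 - c * v 0‖ * ‖(φ : L2Seq)‖
    _ = ‖(c' * u 0 - c * v 0) • (φ : L2Seq)‖ := (norm_smul _ _).symm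
    _ ≤ ‖h‖ := lp.norm_mono two_ne_zero hle
    _ ≤ ‖(‖u‖ * r) • lp.toNorm v‖ + ‖(‖v‖ * r) • lp.toNorm u‖ := norm_add_le _ _
    _ = 2 * ‖u‖ * ‖v‖ * r := by
      rw [norm_smul, norm_smul, lp.norm_toNorm, lp.norm_toNorm,
        Real.norm_of_nonneg (by positivity), Real.norm_of_nonneg (by positivity)]
      ring

theorem IsJacobiSolution.memℓp {z c : ℂ} {u : ℕ → ℂ} (hu : IsJacobiSolution q b z c u)
    (hJ : ¬ IsSelfAdjoint (jacobiOperator q b)) : Memℓp u 2 := by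
  obtain ⟨φ, ψ, hφ, hψ, L, hL, hW⟩ := exists_tendsto_wronskian hJ
  obtain ⟨N, hdom⟩ := exists_dominating_sequence hφ hψ hL hW
  have hnonneg : 0 ≤ ∑ k ∈ Finset.range (N + 1), ‖u k‖ := by positivity
  obtain ⟨h, hmem, hle⟩ := hdom ‖z‖ (‖c‖ + ∑ k ∈ Finset.range (N + 1), ‖u k‖)
  refine hmem.mono (hle z c u hu le_rfl (by linarith) fun k hk => ?_)
  have : ‖u k‖ ≤ ∑ k ∈ Finset.range (N + 1), ‖u k‖ :=
    Finset.single_le_sum (fun j _ => norm_nonneg (u j)) (Finset.mem_range.2 (by omega))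
  linarith [norm_nonneg c]

theorem isRegularOperator_jacobiOperator (hb : ∀ k, b k ≠ 0)
    (hJ : ¬ IsSelfAdjoint (jacobiOperator q b)) : IsRegularOperator (jacobiOperator q b) := by
  refine isRegularOperator_closure isSymmetricOperator_jacobiPre.isClosable fun z => ?_
  have hπ := isJacobiSolution_firstKindPoly (q := q) hb z
  have hθ := isJacobiSolution_secondKindPoly (q := q) hb z
  let π : L2Seq := ⟨_, hπ.memℓp hJ⟩
  let θ : L2Seq := ⟨_, hθ.memℓp hJ⟩
  refine ⟨2 * ‖π‖ * ‖θ‖, fun φ => ?_⟩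
  have hle := norm_mul_norm_le_of_isJacobiSolution (u := π) (v := θ) hπ hθ φ
  simpa only [π, θ, firstKindPoly, secondKindPoly, map_one, map_zero, mul_one, mul_zero, sub_zero,
    norm_one, one_mul] using hle

/-! ### The entire function of the polynomials of the first kind -/

/-- The sequence `π(z)` of the polynomials of the first kind, as a vector of `ℓ²(ℕ)`; it is square
summable because `J` is not selfadjoint. -/
noncomputable def firstKindVector (hb : ∀ k, b k ≠ 0)
    (hJ : ¬ IsSelfAdjoint (jacobiOperator q b)) (z : ℂ) : L2Seq :=
  ⟨fun k => Polynomial.aeval z (firstKindPoly q b k),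
    (isJacobiSolution_firstKindPoly hb z).memℓp hJ⟩

variable (hb : ∀ k, b k ≠ 0) (hJ : ¬ IsSelfAdjoint (jacobiOperator q b))

include hb hJ

theorem firstKindVector_apply (z : ℂ) (k : ℕ) :
    firstKindVector hb hJ z k = Polynomial.aeval z (firstKindPoly q b k) :=
  rfl

theorem inner_firstKindVector_canonicalVector_zero (z : ℂ) :
    ⟪firstKindVector hb hJ z, canonicalVector 0⟫_ℂ = 1 := by
  simp [canonicalVector, lp.inner_single_right, firstKindVector_apply, firstKindPoly]

theorem firstKindVector_ne_zero (z : ℂ) : firstKindVector hb hJ z ≠ 0 := by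
  intro h
  simpa [h] using inner_firstKindVector_canonicalVector_zero hb hJ z

theorem star_firstKindVector (z : ℂ) :
    star (firstKindVector hb hJ z) = firstKindVector hb hJ (conj z) := by
  ext k
  simp [firstKindVector_apply, Polynomial.aeval_conj]

theorem kernelSub_adjoint_jacobiOperator (z : ℂ) :
    kernelSub (jacobiOperator q b).adjoint z = Submodule.span ℂ {firstKindVector hb hJ z} := by
  ext φ
  rw [mem_kernelSub_adjoint_jacobiOperator, Submodule.mem_span_singleton]
  constructor
  · exact fun hφ => ⟨φ 0, lp.ext (funext fun k => (hφ.eq_mul_firstKindPoly hb k).symm)⟩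
  · rintro ⟨a, rfl⟩
    exact mul_zero a ▸ (isJacobiSolution_firstKindPoly hb z).const_mul a

theorem rank_kernelSub_adjoint_jacobiOperator (z : ℂ) :
    Module.rank ℂ (kernelSub (jacobiOperator q b).adjoint z) = 1 := by
  rw [kernelSub_adjoint_jacobiOperator hb hJ, ← Module.finrank_eq_rank,
    finrank_span_singleton (firstKindVector_ne_zero hb hJ z), Nat.cast_one]

theorem differentiable_firstKindVector : Differentiable ℂ (firstKindVector hb hJ) := by
  obtain ⟨φ, ψ, hφ, hψ, L, hL, hW⟩ := exists_tendsto_wronskian hJ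
  obtain ⟨N, hdom⟩ := exists_dominating_sequence hφ hψ hL hW
  intro z₀
  obtain ⟨S, hS⟩ := (isCompact_closedBall (0 : ℂ) (‖z₀‖ + 1)).exists_bound_of_continuousOn
    (f := fun z (k : Fin (N + 1)) => Polynomial.aeval z (firstKindPoly q b k)) (by fun_prop)
  have hS₀ : 0 ≤ S :=
    (norm_nonneg _).trans (hS 0 (Metric.mem_closedBall_self (by positivity)))
  obtain ⟨h, hmem, hle⟩ := hdom (‖z₀‖ + 1) S
  have hdiff : DifferentiableOn ℂ (firstKindVector hb hJ) (Metric.ball 0 (‖z₀‖ + 1)) := by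
    refine differentiableOn_lp_of_dominated (by simp) Metric.isOpen_ball
      (fun k => (Polynomial.differentiable_aeval _).differentiableOn) ⟨h, hmem⟩ fun z hz k => ?_
    have hz' := Metric.ball_subset_closedBall hz
    refine (hle z 0 _ (isJacobiSolution_firstKindPoly hb z) (by simpa using hz') (by simpa)
      (fun k hk => ?_) k).trans (le_abs_self _)
    exact (norm_le_pi_norm _ (⟨k, by omega⟩ : Fin (N + 1))).trans (hS z hz')
  exact hdiff.differentiableAt (Metric.isOpen_ball.mem_nhds (by simp))

theorem isEntireGauge_canonicalVector_zero :
    IsEntireGauge (jacobiOperator q b) (canonicalVector 0) :=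
  (isRegularOperator_jacobiOperator hb hJ).isEntireGauge
    isSymmetricOperator_jacobiOperator.dense_domain (kernelSub_adjoint_jacobiOperator hb hJ)
    fun z => (inner_firstKindVector_canonicalVector_zero hb hJ z).trans_ne one_ne_zero

theorem isEntireOperator_jacobiOperator : IsEntireOperator (jacobiOperator q b) where
  regular := isRegularOperator_jacobiOperator hb hJ
  symmetric := isSymmetricOperator_jacobiOperator
  deficiency_pos := rank_kernelSub_adjoint_jacobiOperator hb hJ Complex.I
  deficiency_neg := rank_kernelSub_adjoint_jacobiOperator hb hJ (-Complex.I)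
  exists_gauge := ⟨_, isEntireGauge_canonicalVector_zero hb hJ⟩

theorem isKreinFunction_firstKindVector :
    IsKreinFunction (jacobiOperator q b) (fun φ : L2Seq => star φ) (firstKindVector hb hJ) where
  entire := differentiable_firstKindVector hb hJ
  zero_free := firstKindVector_ne_zero hb hJ
  mem_kernel z := mem_kernelSub_adjoint_jacobiOperator.2 (isJacobiSolution_firstKindPoly hb z)
  real := star_firstKindVector hb hJ

end JacobiOperator

theorem proposition5p6_general (q b : ℕ → ℝ) (hb : ∀ k, b k ≠ 0)
    (hJ : ¬ IsSelfAdjoint (jacobiOperator q b)) :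
    IsEntireOperator (jacobiOperator q b) ∧
    IsEntireGauge (jacobiOperator q b) (canonicalVector 0) ∧
    IsConjugation (fun φ : L2Seq => star φ) ∧
    CommutesWith (fun φ : L2Seq => star φ) (jacobiOperator q b) ∧
    ∃ ξ : ℂ → L2Seq,
      (∀ z k, ξ z k = Polynomial.aeval z (firstKindPoly q b k)) ∧
      IsKreinFunction (jacobiOperator q b) (fun φ : L2Seq => star φ) ξ ∧
      ∀ z, ⟪ξ (conj z), canonicalVector 0⟫_ℂ = 1 :=
  ⟨isEntireOperator_jacobiOperator hb hJ, isEntireGauge_canonicalVector_zero hb hJ,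
    isConjugation_star, commutesWith_star_jacobiOperator, firstKindVector hb hJ,
    firstKindVector_apply hb hJ, isKreinFunction_firstKindVector hb hJ,
    fun z => inner_firstKindVector_canonicalVector_zero hb hJ (conj z)⟩

theorem proposition5p6 (q b : ℕ → ℝ) (hb : ∀ k, 0 < b k)
    (hJ : ¬ IsSelfAdjoint (jacobiOperator q b)) :
    IsEntireOperator (jacobiOperator q b) ∧
    IsEntireGauge (jacobiOperator q b) (canonicalVector 0) ∧
    IsConjugation (fun φ : L2Seq => star φ) ∧
    CommutesWith (fun φ : L2Seq => star φ) (jacobiOperator q b) ∧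
    ∃ ξ : ℂ → L2Seq,
      (∀ z k, ξ z k = Polynomial.aeval z (firstKindPoly q b k)) ∧
      IsKreinFunction (jacobiOperator q b) (fun φ : L2Seq => star φ) ξ ∧
      ∀ z, ⟪ξ (conj z), canonicalVector 0⟫_ℂ = 1 :=
  proposition5p6_general q b (fun k => (hb k).ne') hJ
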